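/- Let $\mathbb N=\{1,2,\dots\}$ and $\mathbb N_0=\mathbb N\cup\{0\}$. For a countable set $S$, a potential on $\{-1,1\}^S$ is a real function $U(A,\sigma)$ of finite sets $A\subset S$ and configurations $\sigma\in\{-1,1\}^S$ such that $U(A,\sigma)$ depends only on $\sigma_A$ and $\sum_{A\ni i}\max_{\sigma}|U(A,\sigma)|<\infty$ for every $i\in S$. A Gibbs measure for $U$ is a probability measure $\mu$ on $\{-1,1\}^S$ (with the product $\sigma$-algebra) such that $\mu\gamma_\Lambda=\mu$ for every finite $\Lambda\subset S$, where $$\gamma_\Lambda(\zeta_\Lambda\mid\eta)=\frac{e^{-H_\Lambda(\zeta_\Lambda\eta_{\Lambda^c})}}{Z_\Lambda(\eta)},\qquad H_\Lambda(\sigma)=\sum_{A\cap\Lambda\neq\emptyset}U(A,\sigma),\qquad Z_\Lambda(\eta)=\sum_{\zeta\in\{-1,1\}^\Lambda}e^{-H_\Lambda(\zeta_\Lambda\eta_{\Lambda^c})}.$$ Let $d\ge 0$, let $p_1,\dots,p_d$ be distinct primes, and write $p^x=\prod_{i=1}^d p_i^{x_i}$ for $x\in\mathbb N_0^d$. Let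 $U$ be a potential on $\{-1,1\}^{\mathbb N}$ that is multiplication invariant, i.e. $U(iA,\sigma)=U(A,T_i\sigma)$ with $(T_i\sigma)_j=\sigma_{ij}$ for all $i\in\mathbb N$, all finite $A\subset\mathbb N$ and all $\sigma$, and that involves only the primes $p_1,\dots,p_d$, i.e. $U(A,\cdot)=0$ unless $A=\{i\,p^{x}:x\in B\}$ for some $i\in\mathbb N$ and some finite $B\subset\mathbb N_0^d$. Let $V$ be the associated shift-invariant potential on $\{-1,1\}^{\mathbb N_0^d}$, given by $V(B,\tau)=U(\{p^x:x\in B\},\sigma)$ for any $\sigma$ with $\sigma_{p^x}=\tau_x$ for all $x\in\mathbb N_0^d$. Assume that $V$ has a unique Gibbs measure $\mu^V_\infty$ on $\{-1,1\}^{\mathbb N_0^d}$. Then $U$ has a unique Gibbs measure $\mu^U_\infty$ on $\{-1,1\}^{\mathbb N}$. Under $\mu^U_\infty$, the layers $\tau^r=(\sigma_{r p^x})_{x\in\mathbb N_0^d}$, indexed by the $r\in\mathbb N$ divisible by none of $p_1,\dots,p_d$, are independent, and each of them has distribution $\mu^V_\infty$. -/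

import Mathlib

open MeasureTheory ProbabilityTheory

namespace MultGibbs

noncomputable section

/-- Spin configurations on the set of sites `S`: elements of `{-1, 1}^S`, where `{-1, 1}` is the
type `ℤˣ` of units of `ℤ`.  It carries the product σ-algebra. -/
abbrev Config (S : Type) : Type := S → ℤˣ

/-- An interaction: a real function of a finite set of sites and a configuration. -/
abbrev Interaction (S : Type) : Type := Finset S → Config S → ℝ

/-- A potential: `U(A, σ)` depends only on `σ_A`, and `∑_{A ∋ i} max_σ |U(A, σ)| < ∞` for every
site `i`. -/
structure IsPotential {S : Type} (U : Interaction S) : Prop where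
  depends : ∀ (A : Finset S) (σ σ' : Config S), (∀ i ∈ A, σ i = σ' i) → U A σ = U A σ'
  summable : ∀ i : S, Summable fun A : {A : Finset S // i ∈ A} => ⨆ σ : Config S, |U A.1 σ|

/-- The Hamiltonian in the finite volume `Λ`, boundary terms included:
`H_Λ(σ) = ∑_{A ∩ Λ ≠ ∅} U(A, σ)`. -/
def hamiltonian {S : Type} (U : Interaction S) (Λ : Finset S) (σ : Config S) : ℝ :=
  ∑' A : {A : Finset S // ∃ i ∈ A, i ∈ Λ}, U A.1 σ

/-- The configuration `ζ_Λ η_{Λᶜ}`. -/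
def glue {S : Type} [DecidableEq S] (Λ : Finset S) (ζ : Λ → ℤˣ) (η : Config S) : Config S :=
  fun i => if h : i ∈ Λ then ζ ⟨i, h⟩ else η i

/-- The partition function in `Λ` with boundary condition `η`. -/
def partitionFunction {S : Type} [DecidableEq S] (U : Interaction S) (Λ : Finset S)
    (η : Config S) : ℝ :=
  ∑ ζ : Λ → ℤˣ, Real.exp (-hamiltonian U Λ (glue Λ ζ η))

/-- The Gibbs distribution in `Λ` with boundary condition `η`, as a measure on the configurations
of the whole system. -/
def gibbsKernel {S : Type} [DecidableEq S] (U : Interaction S) (Λ : Finset S)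
    (η : Config S) : Measure (Config S) :=
  ∑ ζ : Λ → ℤˣ,
    ENNReal.ofReal (Real.exp (-hamiltonian U Λ (glue Λ ζ η)) / partitionFunction U Λ η) •
      Measure.dirac (glue Λ ζ η)

/-- Gibbs measures for `U`: the probability measures that satisfy the Dobrushin–Lanford–Ruelle
equations `μ γ_Λ = μ` for all finite `Λ`. -/
structure IsGibbs {S : Type} [DecidableEq S] (U : Interaction S) (μ : Measure (Config S)) :
    Prop where
  isProbabilityMeasure : IsProbabilityMeasure μ
  dlr : ∀ (Λ : Finset S) (E : Set (Config S)), MeasurableSet E →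
    ∫⁻ η, gibbsKernel U Λ η E ∂μ = μ E

/-- `μ` is a Gibbs measure for `U`, and it is the only one. -/
def IsUniqueGibbs {S : Type} [DecidableEq S] (U : Interaction S) (μ : Measure (Config S)) :
    Prop :=
  IsGibbs U μ ∧ ∀ ν : Measure (Config S), IsGibbs U ν → ν = μ

/-- The multiplicative shift `(T_i σ)_j = σ_{ij}`. -/
def mulShift (i : ℕ+) (σ : Config ℕ+) : Config ℕ+ := fun j => σ (i * j)

/-- Multiplication invariance: `U(iA, σ) = U(A, T_i σ)`. -/
def MulInvariant (U : Interaction ℕ+) : Prop :=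
  ∀ (i : ℕ+) (A : Finset ℕ+) (σ : Config ℕ+), U (A.image (i * ·)) σ = U A (mulShift i σ)

/-- `∏ p_i ^ x_i`. -/
def primeProd {d : ℕ} (p : Fin d → Nat.Primes) (x : Fin d → ℕ) : ℕ+ :=
  ∏ i, (p i : ℕ+) ^ x i

/-- The exponents of the primes `p_1, …, p_d` in the factorization of `n`. -/
def exponents {d : ℕ} (p : Fin d → Nat.Primes) (n : ℕ+) : Fin d → ℕ :=
  fun i => (n : ℕ).factorization (p i : ℕ)

/-- Only the primes `p_1, …, p_d` occur in `U`: `U(A, ·)` vanishes unless `A = i B` for a positive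
integer `i` and a finite set `B` of products of powers of `p_1, …, p_d`. -/
def InvolvesOnlyPrimes {d : ℕ} (p : Fin d → Nat.Primes) (U : Interaction ℕ+) : Prop :=
  ∀ (A : Finset ℕ+) (σ : Config ℕ+), U A σ ≠ 0 →
    ∃ (i : ℕ+) (B : Finset (Fin d → ℕ)), A = (B.image (primeProd p)).image (i * ·)

/-- The potential `V` on `ℕ₀^d` associated to `U`: it is `U` on sets of products of powers of
`p_1, …, p_d`, in the coordinates `x ↦ ∏ p_i ^ x_i`.  The configuration `τ ∘ exponents p` has the
value `τ_x` at `∏ p_i ^ x_i`; its other values do not matter, by locality of `U`. -/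
def layerPotential {d : ℕ} (p : Fin d → Nat.Primes) (U : Interaction ℕ+) :
    Interaction (Fin d → ℕ) :=
  fun B τ => U (B.image (primeProd p)) (fun n => τ (exponents p n))

/-- The set of layer indices: the positive integers divisible by none of `p_1, …, p_d`. -/
def layerIndices {d : ℕ} (p : Fin d → Nat.Primes) : Set ℕ+ :=
  {r | ∀ i, ¬ (p i : ℕ+) ∣ r}

/-- The layer spins `τ^r_x = σ_{r ∏ p_i ^ x_i}`. -/
def layer {d : ℕ} (p : Fin d → Nat.Primes) (r : ℕ+) (σ : Config ℕ+) : Config (Fin d → ℕ) :=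
  fun x => σ (r * primeProd p x)

end

end MultGibbs

/-!
Every positive integer is uniquely `r ∏ p_i ^ x_i` with `r` divisible by none of `p_1, …, p_d`, so
the sites `ℕ+` split into layers, indexed by these `r`, each of which is a copy of `ℕ₀^d`.
The interaction `U` couples only sites of one layer, and multiplication invariance says that inside
each layer it is a copy of `V` (`isLayered_layerPotential`).  Everything else is about an arbitrary
decomposition `e : R × X ≃ S` of a countable set of sites for which `U` has this form (`IsLayered`).

The Hamiltonian of a finite volume `Λ` is then the sum over the layers of the Hamiltonians of the
slices of `Λ`, hence the Gibbs kernel of `Λ` is the product of the Gibbs kernels of its slices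
(`IsLayered.gibbsKernel_layerBox`).  Two consequences:

* The product over the layers of the Gibbs measure `μV` of `V` satisfies the DLR equations for `U`.
  On boxes these are products of the DLR equations of `V`, because the layers are independent, and
  boxes determine a measure (`IsLayered.isGibbs_of_map_layersEquiv`).
* Conversely, let `μ` be a Gibbs measure for `U`.  A finite volume inside the layer `r` neither sees
  nor changes the other layers, so the law of the layer `r`, conditioned on an event of positive
  probability in other layers, is a Gibbs measure for `V`; by uniqueness it is `μV`
  (`IsLayered.measure_inter_layerBox`).  By induction on the number of layers, `μ` has the product
  values on all boxes, so it is the product measure (`IsLayered.map_layersEquiv_of_isGibbs`).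
-/

namespace MultGibbs

/-! ### Measurability of Gibbs kernels -/

section Kernel

variable {S : Type}

instance : MeasurableSingletonClass ℤˣ where
  measurableSet_singleton u := ⟨{(u : ℤ)}, measurableSet_singleton _, by ext v; simp [Units.ext_iff]⟩

/-- A local function factors through a finite space. -/
lemma measurable_of_eqOn_finset (A : Finset S) (f : Config S → ℝ)
    (hf : ∀ σ σ' : Config S, (∀ i ∈ A, σ i = σ' i) → f σ = f σ') : Measurable f := by
  classical
  have hfactor : f = (fun τ : A → ℤˣ => f (fun i => if h : i ∈ A then τ ⟨i, h⟩ else 1)) ∘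
      A.restrict := by
    funext σ
    refine hf _ _ fun i hi => ?_
    simp [hi]
  rw [hfactor]
  exact (measurable_of_finite _).comp (Finset.measurable_restrict A)

lemma IsPotential.bddAbove {U : Interaction S} (hU : IsPotential U) (A : Finset S) :
    BddAbove (Set.range fun σ : Config S => |U A σ|) := by
  classical
  have hfin : (Set.range fun τ : A → ℤˣ =>
      |U A (fun i => if h : i ∈ A then τ ⟨i, h⟩ else 1)|).Finite := Set.finite_range _
  refine hfin.bddAbove.mono ?_
  rintro _ ⟨σ, rfl⟩
  refine ⟨A.restrict σ, ?_⟩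
  dsimp only
  rw [hU.depends A _ σ fun i hi => by simp [hi]]

lemma IsPotential.summable_hamiltonian {U : Interaction S} (hU : IsPotential U) (Λ : Finset S)
    (σ : Config S) : Summable fun A : {A : Finset S // ∃ i ∈ A, i ∈ Λ} => U A.1 σ := by
  classical
  have hsite : ∀ i ∈ Λ, Summable
      ({A : Finset S | i ∈ A}.indicator fun A => ⨆ σ : Config S, |U A σ|) := fun i _ =>
    summable_subtype_iff_indicator.mp (hU.summable i)
  have hsum := (summable_sum hsite).comp_injective
    (Subtype.val_injective (p := fun A : Finset S => ∃ i ∈ A, i ∈ Λ))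
  refine Summable.of_norm_bounded hsum ?_
  rintro ⟨A, i, hiA, hiΛ⟩
  have hle : |U A σ| ≤ ⨆ σ : Config S, |U A σ| := le_ciSup (hU.bddAbove A) σ
  have hnn : 0 ≤ ⨆ σ : Config S, |U A σ| := (abs_nonneg _).trans hle
  refine hle.trans ?_
  simp only [Function.comp_apply]
  refine le_trans ?_ (Finset.single_le_sum (f := fun j =>
    {A : Finset S | j ∈ A}.indicator (fun A => ⨆ σ : Config S, |U A σ|) A)
    (fun j _ => Set.indicator_apply_nonneg fun _ => hnn) hiΛ)
  simp [hiA]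

lemma measurable_hamiltonian [Countable S] {U : Interaction S}
    (hU : ∀ (A : Finset S) (σ σ' : Config S), (∀ i ∈ A, σ i = σ' i) → U A σ = U A σ')
    (Λ : Finset S) : Measurable (hamiltonian U Λ) :=
  Measurable.tsum fun A => measurable_of_eqOn_finset A.1 _ (hU A.1)

variable [DecidableEq S]

lemma measurable_glue (Λ : Finset S) (ζ : Λ → ℤˣ) : Measurable (glue Λ ζ) := by
  refine measurable_pi_lambda _ fun i => ?_
  by_cases h : i ∈ Λ
  · simp only [glue, h, dite_true, measurable_const]
  · simp only [glue, h, dite_false]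
    exact measurable_pi_apply i

lemma gibbsKernel_apply (U : Interaction S) (Λ : Finset S) (η : Config S) {E : Set (Config S)}
    (hE : MeasurableSet E) :
    gibbsKernel U Λ η E = ∑ ζ : Λ → ℤˣ,
      ENNReal.ofReal (Real.exp (-hamiltonian U Λ (glue Λ ζ η)) / partitionFunction U Λ η) *
        E.indicator 1 (glue Λ ζ η) := by
  simp [gibbsKernel, Measure.finsetSum_apply, hE]

lemma partitionFunction_pos (U : Interaction S) (Λ : Finset S) (η : Config S) :
    0 < partitionFunction U Λ η :=
  Finset.sum_pos (fun _ _ => Real.exp_pos _) Finset.univ_nonempty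

lemma gibbsKernel_univ (U : Interaction S) (Λ : Finset S) (η : Config S) :
    gibbsKernel U Λ η Set.univ = 1 := by
  have hZ := partitionFunction_pos U Λ η
  rw [gibbsKernel_apply U Λ η MeasurableSet.univ]
  simp only [Set.indicator_univ, Pi.one_apply, mul_one]
  rw [← ENNReal.ofReal_sum_of_nonneg fun _ _ => by positivity, ← Finset.sum_div]
  change ENNReal.ofReal (partitionFunction U Λ η / partitionFunction U Λ η) = 1
  rw [div_self hZ.ne', ENNReal.ofReal_one]

lemma gibbsKernel_empty (U : Interaction S) (η : Config S) {E : Set (Config S)}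
    (hE : MeasurableSet E) : gibbsKernel U ∅ η E = E.indicator 1 η := by
  have hglue : ∀ ζ : (∅ : Finset S) → ℤˣ, glue ∅ ζ η = η := fun ζ => by
    funext i; simp [glue]
  have huniv := gibbsKernel_univ U ∅ η
  rw [gibbsKernel_apply U ∅ η MeasurableSet.univ] at huniv
  rw [gibbsKernel_apply U ∅ η hE]
  simp only [Set.indicator_univ, Pi.one_apply, mul_one] at huniv
  simp only [hglue] at huniv ⊢
  rw [← Finset.sum_mul, huniv, one_mul]

lemma measurable_gibbsKernel_apply [Countable S] {U : Interaction S}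
    (hU : ∀ (A : Finset S) (σ σ' : Config S), (∀ i ∈ A, σ i = σ' i) → U A σ = U A σ')
    (Λ : Finset S) {E : Set (Config S)} (hE : MeasurableSet E) :
    Measurable fun η => gibbsKernel U Λ η E := by
  simp only [gibbsKernel_apply U Λ _ hE]
  have hw : ∀ ζ : Λ → ℤˣ,
      Measurable fun η => Real.exp (-hamiltonian U Λ (glue Λ ζ η)) := fun ζ =>
    ((measurable_hamiltonian hU Λ).comp (measurable_glue Λ ζ)).neg.exp
  have hZ : Measurable (partitionFunction U Λ) := Finset.measurable_sum _ fun ζ _ => hw ζ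
  refine Finset.measurable_sum _ fun ζ _ => ?_
  exact ((hw ζ).div hZ).ennreal_ofReal.mul
    ((measurable_one.indicator hE).comp (measurable_glue Λ ζ))

end Kernel

/-! ### Factorization over layers -/

section Layered

variable {S R X : Type}

/-- The restriction of a configuration to the layer `r`, for a decomposition `e : R × X ≃ S` of
the sites into layers indexed by `R`, each of which is a copy of `X`. -/
def restrictLayer (e : R × X ≃ S) (r : R) (σ : Config S) : Config X := fun x => σ (e (r, x))

/-- The trace of a finite volume on the layer `r`, in the coordinates of that layer. -/
noncomputable def slice (e : R × X ≃ S) (Λ : Finset S) (r : R) : Finset X :=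
  Λ.preimage (fun x => e (r, x)) fun _ _ _ _ h => by simpa using h

@[simp]
lemma mem_slice {e : R × X ≃ S} {Λ : Finset S} {r : R} {x : X} :
    x ∈ slice e Λ r ↔ e (r, x) ∈ Λ := by
  exact Finset.mem_preimage

lemma measurable_restrictLayer (e : R × X ≃ S) (r : R) : Measurable (restrictLayer e r) :=
  measurable_pi_lambda _ fun _ => measurable_pi_apply _

/-- The configurations whose restrictions to the layers `r ∈ s` lie in the sets `E r`. -/
def layerBox (e : R × X ≃ S) (s : Finset R) (E : R → Set (Config X)) : Set (Config S) :=
  ⋂ r ∈ s, restrictLayer e r ⁻¹' E r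

lemma measurableSet_layerBox (e : R × X ≃ S) (s : Finset R) {E : R → Set (Config X)}
    (hE : ∀ r, MeasurableSet (E r)) : MeasurableSet (layerBox e s E) :=
  s.measurableSet_biInter fun r _ => measurable_restrictLayer e r (hE r)

lemma indicator_layerBox (e : R × X ≃ S) (s : Finset R) (E : R → Set (Config X))
    (σ : Config S) :
    (layerBox e s E).indicator (1 : Config S → ENNReal) σ =
      ∏ r ∈ s, (E r).indicator (1 : Config X → ENNReal) (restrictLayer e r σ) := by
  classical
  by_cases hσ : σ ∈ layerBox e s E
  · rw [Set.indicator_of_mem hσ]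
    have hone : ∀ r ∈ s, (E r).indicator (1 : Config X → ENNReal) (restrictLayer e r σ) = 1 :=
      fun r hr => Set.indicator_of_mem (Set.mem_preimage.mp (Set.mem_iInter₂.mp hσ r hr)) _
    rw [Finset.prod_eq_one hone, Pi.one_apply]
  · rw [Set.indicator_of_notMem hσ]
    simp only [layerBox, Set.mem_iInter, not_forall] at hσ
    obtain ⟨r, hr, hrE⟩ := hσ
    exact (Finset.prod_eq_zero hr (Set.indicator_of_notMem (Set.mem_preimage.not.mp hrE) _)).symm

/-- Under the decomposition `e : R × X ≃ S`, the interaction `U` couples only sites of one and the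
same layer, and inside each layer it is a copy of `V`. -/
structure IsLayered [DecidableEq S] (e : R × X ≃ S) (U : Interaction S) (V : Interaction X) :
    Prop where
  apply_image : ∀ (r : R) (B : Finset X) (σ : Config S),
    U (B.image fun x => e (r, x)) σ = V B (restrictLayer e r σ)
  exists_eq_image : ∀ (A : Finset S) (σ : Config S), U A σ ≠ 0 →
    ∃ (r : R) (B : Finset X), A = B.image fun x => e (r, x)

variable [DecidableEq S] {e : R × X ≃ S} {U : Interaction S} {V : Interaction X}

/-- The locality of `V` is inherited from `U` through any one layer. -/
lemma IsLayered.depends (h : IsLayered e U V) (hU : IsPotential U) (r : R) (B : Finset X)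
    (τ τ' : Config X) (hτ : ∀ x ∈ B, τ x = τ' x) : V B τ = V B τ' := by
  have hlift : ∀ τ : Config X, V B τ = U (B.image fun x => e (r, x)) fun i => τ (e.symm i).2 :=
    fun τ => by
      rw [h.apply_image]
      congr 1
      funext x
      simp [restrictLayer]
  rw [hlift, hlift]
  refine hU.depends _ _ _ fun i hi => ?_
  obtain ⟨x, hx, rfl⟩ := Finset.mem_image.mp hi
  simpa using hτ x hx

/-- A set that meets `Λ` and carries a nonzero interaction lies in exactly one layer, and there it
meets the slice of `Λ`; so the sum over such sets splits into a sum over the layers. -/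
lemma IsLayered.hamiltonian_eq_sum (h : IsLayered e U V) (hU : IsPotential U) (Λ : Finset S)
    (s : Finset R) (hs : ∀ i ∈ Λ, (e.symm i).1 ∈ s) (σ : Config S) :
    hamiltonian U Λ σ = ∑ r ∈ s, hamiltonian V (slice e Λ r) (restrictLayer e r σ) := by
  let g : (Σ r : s, {B : Finset X // ∃ x ∈ B, x ∈ slice e Λ r}) →
      {A : Finset S // ∃ i ∈ A, i ∈ Λ} := fun q =>
    ⟨q.2.1.image fun x => e (q.1, x), by
      obtain ⟨x, hx, hxΛ⟩ := q.2.2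
      exact ⟨e (q.1, x), Finset.mem_image_of_mem _ hx, mem_slice.mp hxΛ⟩⟩
  have hg : Function.Injective g := by
    rintro ⟨⟨r, hr⟩, ⟨B, hB⟩⟩ ⟨⟨r', hr'⟩, ⟨B', hB'⟩⟩ hq
    have himage : (B.image fun x => e (r, x)) = B'.image fun x => e (r', x) :=
      congrArg Subtype.val hq
    -- a set that meets `Λ` is nonempty, so it determines its layer
    obtain rfl : r = r' := by
      obtain ⟨x, hx, -⟩ := hB
      have hmem : e (r, x) ∈ B'.image fun x => e (r', x) :=
        himage ▸ Finset.mem_image_of_mem _ hx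
      obtain ⟨x', -, hx'⟩ := Finset.mem_image.mp hmem
      simpa using (congrArg Prod.fst (e.injective hx')).symm
    obtain rfl : B = B' :=
      Finset.image_injective (f := fun x => e (r, x)) (fun _ _ h => by simpa using h) himage
    rfl
  have hsupp : Function.support (fun A : {A : Finset S // ∃ i ∈ A, i ∈ Λ} => U A.1 σ) ⊆
      Set.range g := by
    rintro ⟨A, hA⟩ hne
    obtain ⟨r, B, rfl⟩ := h.exists_eq_image A σ hne
    obtain ⟨i, hi, hiΛ⟩ := hA
    obtain ⟨x, hx, rfl⟩ := Finset.mem_image.mp hi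
    exact ⟨⟨⟨r, by simpa using hs _ hiΛ⟩, ⟨B, x, hx, mem_slice.mpr hiΛ⟩⟩, rfl⟩
  have hsum := (hU.summable_hamiltonian Λ σ).comp_injective hg
  rw [hamiltonian, ← hg.tsum_eq hsupp]
  refine (hsum.tsum_sigma' hsum.sigma_factor).trans ?_
  rw [tsum_fintype, ← Finset.sum_coe_sort s]
  exact Finset.sum_congr rfl fun r _ => tsum_congr fun B => h.apply_image r.1 B.1 σ

/-- Spins in `Λ` are families of spins in the slices of `Λ`. -/
noncomputable def sliceEquiv (e : R × X ≃ S) (Λ : Finset S) (s : Finset R) (hs : ∀ i ∈ Λ, (e.symm i).1 ∈ s) :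
    (Λ → ℤˣ) ≃ (∀ r : s, slice e Λ r → ℤˣ) where
  toFun ζ r x := ζ ⟨e (r, x), mem_slice.mp x.2⟩
  invFun ξ i := ξ ⟨(e.symm i).1, hs i i.2⟩ ⟨(e.symm i).2, by simp⟩
  left_inv ζ := by
    funext i
    simp
  right_inv ξ := by
    have key : ∀ (r : s) (x : slice e Λ r) (q : R × X), q = (r.1, x.1) →
        ∀ (h₁ : q.1 ∈ s) (h₂ : q.2 ∈ slice e Λ q.1), ξ ⟨q.1, h₁⟩ ⟨q.2, h₂⟩ = ξ r x := by
      rintro r x _ rfl _ _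
      rfl
    funext r x
    exact key r x _ (e.symm_apply_apply _) _ _

variable [DecidableEq X]

lemma restrictLayer_glue (Λ : Finset S) (s : Finset R) (hs : ∀ i ∈ Λ, (e.symm i).1 ∈ s)
    (ζ : Λ → ℤˣ) (η : Config S) (r : s) :
    restrictLayer e r (glue Λ ζ η) =
      glue (slice e Λ r) (sliceEquiv e Λ s hs ζ r) (restrictLayer e r η) := by
  funext x
  simp [restrictLayer, glue, sliceEquiv]

lemma IsLayered.exp_hamiltonian_glue (h : IsLayered e U V) (hU : IsPotential U) (Λ : Finset S)
    (s : Finset R) (hs : ∀ i ∈ Λ, (e.symm i).1 ∈ s) (ζ : Λ → ℤˣ) (η : Config S) :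
    Real.exp (-hamiltonian U Λ (glue Λ ζ η)) = ∏ r : s, Real.exp (-hamiltonian V (slice e Λ r)
      (glue (slice e Λ r) (sliceEquiv e Λ s hs ζ r) (restrictLayer e r η))) := by
  rw [h.hamiltonian_eq_sum hU Λ s hs, ← Real.exp_sum, ← Finset.sum_coe_sort s,
    ← Finset.sum_neg_distrib]
  simp only [restrictLayer_glue Λ s hs]

lemma IsLayered.partitionFunction_eq_prod (h : IsLayered e U V) (hU : IsPotential U)
    (Λ : Finset S) (s : Finset R) (hs : ∀ i ∈ Λ, (e.symm i).1 ∈ s) (η : Config S) :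
    partitionFunction U Λ η =
      ∏ r : s, partitionFunction V (slice e Λ r) (restrictLayer e r η) := by
  classical
  simp only [partitionFunction, h.exp_hamiltonian_glue hU Λ s hs]
  rw [Fintype.prod_sum]
  exact Fintype.sum_equiv (sliceEquiv e Λ s hs) _ _ fun _ => rfl

lemma IsLayered.gibbsKernel_layerBox_of_subset (h : IsLayered e U V) (hU : IsPotential U)
    (Λ : Finset S) (s : Finset R) (hs : ∀ i ∈ Λ, (e.symm i).1 ∈ s) {E : R → Set (Config X)}
    (hE : ∀ r, MeasurableSet (E r)) (η : Config S) :
    gibbsKernel U Λ η (layerBox e s E) =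
      ∏ r ∈ s, gibbsKernel V (slice e Λ r) (restrictLayer e r η) (E r) := by
  classical
  rw [gibbsKernel_apply _ _ _ (measurableSet_layerBox e s hE), ← Finset.prod_coe_sort s]
  simp only [gibbsKernel_apply _ _ _ (hE _)]
  rw [Fintype.prod_sum]
  refine Fintype.sum_equiv (sliceEquiv e Λ s hs) _ _ fun ζ => ?_
  rw [Finset.prod_mul_distrib, indicator_layerBox, ← Finset.prod_coe_sort s,
    ← ENNReal.ofReal_prod_of_nonneg fun r _ =>
      div_nonneg (Real.exp_pos _).le (partitionFunction_pos V _ _).le,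
    Finset.prod_div_distrib, ← h.exp_hamiltonian_glue hU Λ s hs,
    ← h.partitionFunction_eq_prod hU Λ s hs]
  simp only [restrictLayer_glue Λ s hs]

/-- The Gibbs kernel of a layered interaction is the product over the layers of the Gibbs kernels
of the slices. -/
lemma IsLayered.gibbsKernel_layerBox (h : IsLayered e U V) (hU : IsPotential U)
    (Λ : Finset S) (s : Finset R) {E : R → Set (Config X)}
    (hE : ∀ r, MeasurableSet (E r)) (η : Config S) :
    gibbsKernel U Λ η (layerBox e s E) =
      ∏ r ∈ s, gibbsKernel V (slice e Λ r) (restrictLayer e r η) (E r) := by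
  classical
  -- enlarge `s` to contain all layers that meet `Λ`, without constraint in the new layers
  let E' : R → Set (Config X) := fun r => if r ∈ s then E r else Set.univ
  have hE' : ∀ r, MeasurableSet (E' r) := fun r => by
    by_cases hr : r ∈ s <;> simp [E', hr, hE r]
  have hbox : layerBox e s E = layerBox e (s ∪ Λ.image fun i => (e.symm i).1) E' := by
    ext σ
    simp only [layerBox, Set.mem_iInter, Set.mem_preimage, E']
    refine ⟨fun hσ r _ => ?_, fun hσ r hr => ?_⟩
    · by_cases hr : r ∈ s <;> simp [hr, hσ r]
    · simpa [hr] using hσ r (Finset.mem_union_left _ hr)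
  rw [hbox, h.gibbsKernel_layerBox_of_subset hU Λ (s ∪ Λ.image fun i => (e.symm i).1)
    (fun i hi => Finset.mem_union_right _ (Finset.mem_image_of_mem _ hi)) hE',
    ← Finset.prod_subset Finset.subset_union_left fun r _ hr => by
      simp [E', hr, gibbsKernel_univ]]
  exact Finset.prod_congr rfl fun r hr => by simp [E', hr]

end Layered
/-! ### Gibbs measures of layered interactions -/

section LayeredGibbs

variable {S R X : Type}

/-- A configuration is the same as the family of its restrictions to the layers. -/
def layersEquiv (e : R × X ≃ S) : Config S ≃ᵐ (R → Config X) where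
  toFun σ r := restrictLayer e r σ
  invFun ω i := ω (e.symm i).1 (e.symm i).2
  left_inv σ := by
    funext i
    simp [restrictLayer]
  right_inv ω := by
    funext r x
    simp [restrictLayer]
  measurable_toFun := measurable_pi_lambda _ fun r => measurable_restrictLayer e r
  measurable_invFun := measurable_pi_lambda _ fun i =>
    (measurable_pi_apply (X := fun _ : X => ℤˣ) (e.symm i).2).comp
      (measurable_pi_apply (X := fun _ : R => Config X) (e.symm i).1)

lemma layersEquiv_preimage_pi (e : R × X ≃ S) (s : Finset R) (E : R → Set (Config X)) :
    layersEquiv e ⁻¹' Set.pi s E = layerBox e s E := by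
  ext σ
  simp only [Set.mem_preimage, Set.mem_pi, layerBox, Set.mem_iInter]
  rfl

variable [DecidableEq S] [DecidableEq X] {e : R × X ≃ S} {U : Interaction S} {V : Interaction X}

/-- Conditionally on an event of the layers in `s`, a layer `r ∉ s` is distributed by a Gibbs
measure for `V`, because a finite volume in the layer `r` does not see the other layers.
Uniqueness of that measure gives the product. -/
lemma IsLayered.measure_inter_layerBox (h : IsLayered e U V) (hU : IsPotential U) [Countable X]
    {μV : Measure (Config X)} (hV : IsUniqueGibbs V μV) {μ : Measure (Config S)}
    (hμ : IsGibbs U μ) {s : Finset R} {r : R} (hr : r ∉ s) {E : R → Set (Config X)}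
    (hE : ∀ r, MeasurableSet (E r)) {D : Set (Config X)} (hD : MeasurableSet D) :
    μ (restrictLayer e r ⁻¹' D ∩ layerBox e s E) = μ (layerBox e s E) * μV D := by
  classical
  have := hμ.isProbabilityMeasure
  have hF := measurableSet_layerBox e s hE
  set F := layerBox e s E with hFdef
  have hmeas := measurable_restrictLayer e r
  have happly : ∀ C : Set (Config X), MeasurableSet C →
      (μ.restrict F).map (restrictLayer e r) C = μ (restrictLayer e r ⁻¹' C ∩ F) := fun C hC => by
    rw [Measure.map_apply hmeas hC, Measure.restrict_apply (hmeas hC)]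
  have hdlr : ∀ (B : Finset X) (C : Set (Config X)), MeasurableSet C →
      ∫⁻ τ, gibbsKernel V B τ C ∂((μ.restrict F).map (restrictLayer e r)) =
        (μ.restrict F).map (restrictLayer e r) C := by
    intro B C hC
    have hker := measurable_gibbsKernel_apply (h.depends hU r) B hC
    have hE' : ∀ q, MeasurableSet (Function.update E r C q) := fun q => by
      by_cases hq : q = r
      · subst hq; simpa using hC
      · simpa [hq] using hE q
    have hne : ∀ q ∈ s, q ≠ r := fun q hq hqr => hr (hqr ▸ hq)
    have hbox : restrictLayer e r ⁻¹' C ∩ F = layerBox e (insert r s) (Function.update E r C) := by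
      rw [layerBox, Finset.set_biInter_insert, Function.update_self, hFdef, layerBox]
      congr 1
      exact Set.iInter₂_congr fun q hq => by rw [Function.update_of_ne (hne q hq)]
    rw [happly C hC, lintegral_map hker hmeas, hbox,
      ← hμ.dlr (B.image fun x => e (r, x)) _ (measurableSet_layerBox e _ hE'),
      ← lintegral_indicator hF]
    refine lintegral_congr fun η => ?_
    rw [h.gibbsKernel_layerBox hU _ _ hE', Finset.prod_insert hr, Function.update_self]
    have hslice : slice e (B.image fun x => e (r, x)) r = B := by
      ext x
      simp
    have hprod : ∏ q ∈ s, gibbsKernel V (slice e (B.image fun x => e (r, x)) q)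
        (restrictLayer e q η) (Function.update E r C q) = F.indicator 1 η := by
      rw [hFdef, indicator_layerBox]
      refine Finset.prod_congr rfl fun q hq => ?_
      have hempty : slice e (B.image fun x => e (r, x)) q = ∅ := by
        ext x
        simp [(hne q hq).symm]
      rw [hempty, Function.update_of_ne (hne q hq), gibbsKernel_empty V _ (hE q)]
    -- the factor of the layer `r` is the kernel of `V`, the others restrict the integral to `F`
    rw [hslice, hprod]
    by_cases hη : η ∈ F <;> simp [hη]
  have huniv : (μ.restrict F).map (restrictLayer e r) Set.univ = μ F := by
    rw [happly _ MeasurableSet.univ, Set.preimage_univ, Set.univ_inter]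
  by_cases hzero : μ F = 0
  · rw [hzero, zero_mul]
    exact measure_mono_null Set.inter_subset_right hzero
  have hcond : IsGibbs V ((μ F)⁻¹ • (μ.restrict F).map (restrictLayer e r)) :=
    ⟨⟨by rw [Measure.smul_apply, huniv, smul_eq_mul,
        ENNReal.inv_mul_cancel hzero (measure_ne_top μ F)]⟩,
      fun B C hC => by
        rw [lintegral_smul_measure, hdlr B C hC, Measure.smul_apply]⟩
  rw [← hV.2 _ hcond, Measure.smul_apply, smul_eq_mul, happly D hD, ← mul_assoc,
    ENNReal.mul_inv_cancel hzero (measure_ne_top μ F), one_mul]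

/-- Every Gibbs measure for `U` is the product over the layers of the unique Gibbs measure for
`V`. -/
lemma IsLayered.map_layersEquiv_of_isGibbs (h : IsLayered e U V) (hU : IsPotential U)
    [Countable X] {μV : Measure (Config X)} [IsProbabilityMeasure μV] (hV : IsUniqueGibbs V μV)
    {μ : Measure (Config S)} (hμ : IsGibbs U μ) :
    μ.map (layersEquiv e) = Measure.infinitePi fun _ : R => μV := by
  classical
  have := hμ.isProbabilityMeasure
  refine Measure.eq_infinitePi _ fun s E hE => ?_
  rw [MeasurableEquiv.map_apply, layersEquiv_preimage_pi]
  induction s using Finset.induction_on with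
  | empty => simp [layerBox]
  | insert r s hr ih =>
    rw [Finset.prod_insert hr, ← ih, layerBox, Finset.set_biInter_insert, mul_comm]
    exact h.measure_inter_layerBox hU hV hμ hr hE (hE r)

/-- A product over the layers of a Gibbs measure for `V` is a Gibbs measure for `U`. -/
lemma IsLayered.isGibbs_of_map_layersEquiv (h : IsLayered e U V) (hU : IsPotential U)
    [Countable S] [Countable X] {μV : Measure (Config X)} [IsProbabilityMeasure μV]
    (hV : IsGibbs V μV) {μ : Measure (Config S)}
    (hμ : μ.map (layersEquiv e) = Measure.infinitePi fun _ : R => μV) : IsGibbs U μ := by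
  refine ⟨?_, fun Λ E hE => ?_⟩
  · constructor
    rw [← Set.preimage_univ (f := layersEquiv e), ← MeasurableEquiv.map_apply, hμ, measure_univ]
  have hker : Measurable (gibbsKernel U Λ) := Measure.measurable_of_measurable_coe _ fun C hC =>
    measurable_gibbsKernel_apply hU.depends Λ hC
  have hμ' : μ = (Measure.infinitePi fun _ : R => μV).map (layersEquiv e).symm := by
    rw [← hμ, MeasurableEquiv.map_symm_map]
  have hbind : (μ.bind (gibbsKernel U Λ)).map (layersEquiv e) = μ.map (layersEquiv e) := by
    rw [hμ]
    refine Measure.eq_infinitePi _ fun s C hC => ?_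
    rw [MeasurableEquiv.map_apply, layersEquiv_preimage_pi,
      Measure.bind_apply (measurableSet_layerBox e s hC) hker.aemeasurable]
    simp only [h.gibbsKernel_layerBox hU Λ s hC]
    rw [hμ', lintegral_map_equiv]
    have hmeas : ∀ r, Measurable fun τ => gibbsKernel V (slice e Λ r) τ (C r) := fun r =>
      measurable_gibbsKernel_apply (h.depends hU r) _ (hC r)
    have hind : iIndepFun (fun (r : R) (ω : R → Config X) =>
        gibbsKernel V (slice e Λ r) (ω r) (C r)) (Measure.infinitePi fun _ : R => μV) :=
      iIndepFun_infinitePi hmeas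
    have hcoord : ∀ (r : R) (ω : R → Config X),
        restrictLayer e r ((layersEquiv e).symm ω) = ω r := fun r ω =>
      congrFun ((layersEquiv e).apply_symm_apply ω) r
    simp only [hcoord]
    rw [lintegral_prod_eq_prod_lintegral_of_indepFun s _ hind fun r =>
      (hmeas r).comp (measurable_pi_apply r)]
    refine Finset.prod_congr rfl fun r _ => ?_
    rw [← hV.dlr (slice e Λ r) (C r) (hC r)]
    exact (measurePreserving_eval_infinitePi (fun _ : R => μV) r).lintegral_comp (hmeas r)
  rw [← Measure.bind_apply hE hker.aemeasurable]
  rw [(layersEquiv e).map_measurableEquiv_injective hbind]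

/-- If the layer interaction `V` has a unique Gibbs measure, then so does the layered interaction
`U`; its layers are independent and distributed by the Gibbs measure of `V`. -/
theorem IsLayered.exists_isUniqueGibbs (h : IsLayered e U V) (hU : IsPotential U)
    [Countable S] [Countable X] {μV : Measure (Config X)} (hV : IsUniqueGibbs V μV) :
    ∃ μU : Measure (Config S), IsUniqueGibbs U μU ∧
      iIndepFun (fun r : R => restrictLayer e r) μU ∧
      ∀ r, μU.map (restrictLayer e r) = μV := by
  have := hV.1.isProbabilityMeasure
  let μU := (Measure.infinitePi fun _ : R => μV).map (layersEquiv e).symm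
  have hμU : μU.map (layersEquiv e) = Measure.infinitePi fun _ : R => μV :=
    MeasurableEquiv.map_map_symm _
  have hGibbs : IsGibbs U μU := h.isGibbs_of_map_layersEquiv hU hV.1 hμU
  have := hGibbs.isProbabilityMeasure
  have hmarg : ∀ r, μU.map (restrictLayer e r) = μV := fun r => by
    rw [← Measure.infinitePi_map_eval (fun _ : R => μV) r, ← hμU,
      Measure.map_map (measurable_pi_apply r) (layersEquiv e).measurable]
    rfl
  refine ⟨μU, ⟨hGibbs, fun ν hν => (layersEquiv e).map_measurableEquiv_injective ?_⟩, ?_, hmarg⟩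
  · rw [h.map_layersEquiv_of_isGibbs hU hV hν, hμU]
  · rw [iIndepFun_iff_map_fun_eq_infinitePi_map (measurable_restrictLayer e)]
    simp only [hmarg]
    exact hμU

end LayeredGibbs

/-! ### The layers of the positive integers -/

section PositiveIntegers

variable {d : ℕ} (p : Fin d → Nat.Primes)

lemma primeProd_add (x y : Fin d → ℕ) : primeProd p (x + y) = primeProd p x * primeProd p y := by
  simp [primeProd, pow_add, Finset.prod_mul_distrib]

variable {p}

lemma factorization_primeProd (hp : Function.Injective p) (x : Fin d → ℕ) (i : Fin d) :
    (primeProd p x : ℕ).factorization (p i : ℕ) = x i := by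
  have hcoe : (primeProd p x : ℕ) = ∏ j, (p j : ℕ) ^ x j :=
    (map_prod PNat.coeMonoidHom _ _).trans (Finset.prod_congr rfl fun j _ => PNat.pow_coe _ _)
  rw [hcoe, Nat.factorization_prod fun j _ => pow_ne_zero _ (p j).2.ne_zero,
    Finsupp.finsetSum_apply, Finset.sum_eq_single i]
  · simp [(p i).2.factorization_self]
  · intro j _ hj
    have hne : (p j : ℕ) ≠ p i := fun hji => hj (hp (Subtype.ext hji))
    simp [(p j).2.factorization, hne]
  · simp

lemma exponents_mul_primeProd (hp : Function.Injective p) {r : ℕ+} (hr : r ∈ layerIndices p)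
    (x : Fin d → ℕ) : exponents p (r * primeProd p x) = x := by
  funext i
  have hndvd : ¬ (p i : ℕ) ∣ r := fun hdvd => hr i (PNat.dvd_iff.mpr hdvd)
  rw [exponents, PNat.mul_coe, Nat.factorization_mul r.ne_zero (PNat.ne_zero _),
    Finsupp.add_apply, Nat.factorization_eq_zero_of_not_dvd hndvd, factorization_primeProd hp,
    zero_add]

lemma exists_mul_primeProd_eq (n : ℕ+) :
    ∃ r ∈ layerIndices p, ∃ x, r * primeProd p x = n := by
  induction n using PNat.strongInductionOn with
  | _ n ih =>
    by_cases hn : n ∈ layerIndices p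
    · exact ⟨n, hn, 0, by simp [primeProd]⟩
    · simp only [layerIndices, Set.mem_ofPred_eq, not_forall, not_not] at hn
      obtain ⟨i, m, rfl⟩ := hn
      have hlt : m < p i * m := by
        have h2 := (p i).2.two_le
        have hm := m.pos
        rw [← PNat.coe_lt_coe, PNat.mul_coe]
        change (m : ℕ) < (p i : ℕ) * m
        nlinarith
      obtain ⟨r, hr, x, rfl⟩ := ih m hlt
      refine ⟨r, hr, x + Pi.single i 1, ?_⟩
      have hsingle : primeProd p (Pi.single i 1) = (p i : ℕ+) := by
        rw [primeProd, Finset.prod_eq_single i]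
        · simp
        · intro j _ hj
          simp [hj]
        · simp
      rw [primeProd_add, hsingle, ← mul_assoc, mul_comm]

/-- Every positive integer is uniquely `r ∏ p_i ^ x_i` with `r` divisible by none of the `p_i`. -/
noncomputable def layerDecomposition (hp : Function.Injective p) :
    layerIndices p × (Fin d → ℕ) ≃ ℕ+ :=
  Equiv.ofBijective (fun q => q.1 * primeProd p q.2) <| by
    refine ⟨?_, fun n => ?_⟩
    · rintro ⟨⟨r, hr⟩, x⟩ ⟨⟨r', hr'⟩, x'⟩ h
      dsimp only at h
      have hx : x = x' := by
        rw [← exponents_mul_primeProd hp hr x, h, exponents_mul_primeProd hp hr']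
      subst hx
      simpa using h
    · obtain ⟨r, hr, x, hx⟩ := exists_mul_primeProd_eq (p := p) n
      exact ⟨⟨⟨r, hr⟩, x⟩, hx⟩

lemma isLayered_layerPotential (hp : Function.Injective p) {U : Interaction ℕ+}
    (hU : IsPotential U) (hmul : MulInvariant U) (hprimes : InvolvesOnlyPrimes p U) :
    IsLayered (layerDecomposition hp) U (layerPotential p U) where
  apply_image r B σ := by
    have himage : (B.image fun x => layerDecomposition hp (r, x)) =
        (B.image (primeProd p)).image ((r : ℕ+) * ·) := by
      rw [Finset.image_image]
      rfl
    rw [himage, hmul]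
    refine hU.depends _ _ _ fun n hn => ?_
    obtain ⟨x, -, rfl⟩ := Finset.mem_image.mp hn
    have hx : exponents p (primeProd p x) = x := funext (factorization_primeProd hp x)
    rw [hx]
    rfl
  exists_eq_image A σ hA := by
    obtain ⟨i, B, rfl⟩ := hprimes A σ hA
    obtain ⟨r, hr, y, rfl⟩ := exists_mul_primeProd_eq (p := p) i
    refine ⟨⟨r, hr⟩, B.image (y + ·), ?_⟩
    rw [Finset.image_image, Finset.image_image]
    refine Finset.image_congr fun x _ => ?_
    change r * primeProd p y * primeProd p x = r * primeProd p (y + x)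
    rw [primeProd_add, mul_assoc]

end PositiveIntegers

end MultGibbs

theorem mainTheorem5 {d : ℕ} (p : Fin d → Nat.Primes) (hp : Function.Injective p)
    (U : MultGibbs.Interaction ℕ+) (hU : MultGibbs.IsPotential U)
    (hmul : MultGibbs.MulInvariant U) (hprimes : MultGibbs.InvolvesOnlyPrimes p U)
    (μV : Measure (MultGibbs.Config (Fin d → ℕ)))
    (hV : MultGibbs.IsUniqueGibbs (MultGibbs.layerPotential p U) μV) :
    ∃ μU : Measure (MultGibbs.Config ℕ+),
      MultGibbs.IsUniqueGibbs U μU ∧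
      iIndepFun (fun r : MultGibbs.layerIndices p => MultGibbs.layer p (r : ℕ+)) μU ∧
      ∀ r ∈ MultGibbs.layerIndices p, μU.map (MultGibbs.layer p r) = μV :=
  (MultGibbs.isLayered_layerPotential hp hU hmul hprimes).exists_isUniqueGibbs hU hV |>.imp
    fun _ h => ⟨h.1, h.2.1, fun r hr => h.2.2 ⟨r, hr⟩⟩
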